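/- Let $\epsilon>0$ and $\lambda>0$ be real constants with $\lambda<1-2\epsilon$. Then there is a constant $C>0$, depending only on $\epsilon$ and $\lambda$, such that for every real $N>1$ the following holds: all positive squarefree integers $D\le N$, with at most $$C\,N\exp\left(-\left(\lambda\log\left(\frac{\lambda}{1-2\epsilon}\right)-\lambda+(1-2\epsilon)\right)\log\log N\right)$$ exceptions, have at least $\lambda\log\log N$ prime factors $p$ satisfying $$\epsilon\log\log N<\log\log p<(1-\epsilon)\log\log N.$$ -/

import Mathlib

/-- The set of positive squarefree integers `D ≤ N`, for a real number `N`. -/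
noncomputable def squarefreeUpTo (N : ℝ) : Finset ℕ :=
  {D ∈ Finset.Icc 1 ⌊N⌋₊ | Squarefree D}

/-- The set of prime factors `p` of `D` with
`ε log log N < log log p < (1 - ε) log log N`. -/
noncomputable def mediumPrimeFactors (ε N : ℝ) (D : ℕ) : Finset ℕ :=
  {p ∈ D.primeFactors |
    ε * Real.log (Real.log N) < Real.log (Real.log (p : ℝ)) ∧
      Real.log (Real.log (p : ℝ)) < (1 - ε) * Real.log (Real.log N)}

/-- The exceptional set: positive squarefree `D ≤ N` that do not have at least
`lam * log log N` prime factors in the range above. -/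
noncomputable def exceptionalSet (ε lam N : ℝ) : Finset ℕ :=
  {D ∈ squarefreeUpTo N |
    ¬ (lam * Real.log (Real.log N) ≤ ((mediumPrimeFactors ε N D).card : ℝ))}

/-! Rankin's method. Put `L = log log N`, and let `ω(D)` count the medium primes of `D`. For `0 < z
≤ 1` an exceptional `D` has `z ^ (ω(D) - lam * L) ≥ 1`, so the exceptions number at most `z ^ (-lam
* L) * ∑ z ^ ω(D)` (`card_exceptionalSet_le_rpow_mul_sum`). The summand is multiplicative with
values in `[0, 1]`, so `log_mul_sum_prod_primeFactors_le` bounds the sum by `O(N / log N) * exp (∑ g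
p / p)`. By Mertens' second theorem the medium primes carry reciprocal mass at least `(1 - 2ε) L -
O(1)`, which makes the sum `O(N) * exp (-(1 - z)(1 - 2ε) L)`. The resulting exponent `-lam log z -
(1 - z)(1 - 2ε)` is least at `z = lam / (1 - 2ε)`, which gives the stated rate. -/

/-- The primes `p ≤ n`. -/
def primesUpTo (n : ℕ) : Finset ℕ := {p ∈ Finset.Icc 1 n | p.Prime}

theorem mem_primesUpTo {n p : ℕ} : p ∈ primesUpTo n ↔ p ≤ n ∧ p.Prime := by
  simp only [primesUpTo, Finset.mem_filter, Finset.mem_Icc]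
  exact ⟨fun h => ⟨h.1.2, h.2⟩, fun h => ⟨⟨h.2.one_le, h.1⟩, h.2⟩⟩

/-! ### Mertens' first theorem, from the prime factorization of `n!`. -/

theorem sum_primesUpTo_log_le (n : ℕ) :
    ∑ p ∈ primesUpTo n, Real.log p ≤ Real.log 4 * n := by
  have h := Chebyshev.theta_le_log4_mul_x (x := n) (Nat.cast_nonneg n)
  rw [Chebyshev.theta_eq_sum_primesLE_log] at h
  refine le_trans (le_of_eq ?_) h
  refine Finset.sum_congr ?_ fun _ _ => rfl
  ext p
  simp [mem_primesUpTo, Nat.mem_primesLE]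

theorem log_factorial_eq_sum_primesUpTo (n : ℕ) :
    Real.log (n.factorial : ℝ) =
      ∑ p ∈ primesUpTo n, (n.factorial.factorization p : ℝ) * Real.log p := by
  conv_lhs => rw [← Nat.prod_factorization_pow_eq_self n.factorial_ne_zero]
  have hs : n.factorial.factorization.support ⊆ primesUpTo n := by
    intro p hp
    have hp' : p.Prime := Nat.prime_of_mem_primeFactors (by simpa using hp)
    have hd : p ∣ n.factorial := Nat.dvd_of_mem_primeFactors (by simpa using hp)
    exact mem_primesUpTo.2 ⟨(hp'.dvd_factorial).1 hd, hp'⟩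
  rw [Finsupp.prod_of_support_subset _ hs _ (by simp)]
  push_cast
  rw [Real.log_prod]
  · exact Finset.sum_congr rfl fun p _ => by rw [Real.log_pow]
  · intro p hp
    have := (mem_primesUpTo.1 hp).2.pos
    positivity

theorem log_factorial_le (n : ℕ) : Real.log (n.factorial : ℝ) ≤ n * Real.log n := by
  rw [← Real.log_pow]
  refine Real.log_le_log (by exact_mod_cast n.factorial_pos) ?_
  exact_mod_cast Nat.factorial_le_pow n

theorem le_log_factorial (n : ℕ) : n * Real.log n - n ≤ Real.log (n.factorial : ℝ) := by
  rcases Nat.eq_zero_or_pos n with rfl | hn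
  · simp
  have hn' : (0 : ℝ) < n := by exact_mod_cast hn
  have h : (n : ℝ) ^ n / n.factorial ≤ Real.exp n := Real.pow_div_factorial_le_exp n hn'.le n
  have hf : (0 : ℝ) < n.factorial := by exact_mod_cast n.factorial_pos
  have h2 := Real.log_le_log (by positivity) h
  rw [Real.log_div (by positivity) hf.ne', Real.log_pow, Real.log_exp] at h2
  linarith

/-- This is the cost of replacing `1 / (p - 1)` by `1 / p` in the bound `v_p(n!) ≤ n / (p - 1)`.
Since `log p ≤ 2 √p`, the terms are `O(p ^ (-3/2))`. -/
theorem exists_sum_log_div_mul_pred_le :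
    ∃ K : ℝ, 0 ≤ K ∧ ∀ n : ℕ,
      ∑ p ∈ primesUpTo n, Real.log p / (p * (p - 1)) ≤ K := by
  have hs : Summable fun m : ℕ => 4 * ((m : ℝ) ^ (3 / 2 : ℝ))⁻¹ :=
    (Real.summable_nat_rpow_inv.2 (by norm_num)).mul_left 4
  refine ⟨∑' m : ℕ, 4 * ((m : ℝ) ^ (3 / 2 : ℝ))⁻¹, tsum_nonneg fun m => by positivity,
    fun n => ?_⟩
  refine le_trans (Finset.sum_le_sum fun p hp => ?_)
    (hs.sum_le_tsum (primesUpTo n) fun m _ => by positivity)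
  have h2 : (2 : ℝ) ≤ p := by exact_mod_cast (mem_primesUpTo.1 hp).2.two_le
  have hp0 : (0 : ℝ) < p := by linarith
  have hl : Real.log p ≤ (p : ℝ) ^ (1 / 2 : ℝ) / (1 / 2) :=
    Real.log_le_rpow_div hp0.le (by norm_num)
  have hm : (p : ℝ) ^ (1 / 2 : ℝ) * (p : ℝ) ^ (3 / 2 : ℝ) = p ^ 2 := by
    rw [← Real.rpow_add hp0]; norm_num
  have hr : (0 : ℝ) < (p : ℝ) ^ (3 / 2 : ℝ) := by positivity
  rw [← div_eq_mul_inv, div_le_div_iff₀ (by nlinarith) hr]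
  calc Real.log p * (p : ℝ) ^ (3 / 2 : ℝ)
      ≤ ((p : ℝ) ^ (1 / 2 : ℝ) / (1 / 2)) * (p : ℝ) ^ (3 / 2 : ℝ) := by gcongr
    _ = 2 * p ^ 2 := by rw [← hm]; ring
    _ ≤ 4 * (p * (p - 1)) := by nlinarith

/-- Mertens' first theorem. -/
theorem exists_abs_sum_log_div_sub_log_le :
    ∃ K : ℝ, 0 ≤ K ∧ ∀ n : ℕ, 1 ≤ n →
      |∑ p ∈ primesUpTo n, Real.log p / p - Real.log n| ≤ K := by
  obtain ⟨K, hK0, hK⟩ := exists_sum_log_div_mul_pred_le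
  have hl4 : 0 ≤ Real.log 4 := Real.log_nonneg (by norm_num)
  refine ⟨K + 1 + Real.log 4, by positivity, fun n hn => ?_⟩
  have hn' : (0 : ℝ) < n := by exact_mod_cast hn
  have hlog : ∀ p ∈ primesUpTo n, 0 ≤ Real.log (p : ℝ) := fun p _ => Real.log_natCast_nonneg p
  have htwo : ∀ p ∈ primesUpTo n, (2 : ℝ) ≤ p := fun p hp => by
    exact_mod_cast (mem_primesUpTo.1 hp).2.two_le
  have heq := log_factorial_eq_sum_primesUpTo n
  -- `v_p(n!) ≥ ⌊n / p⌋ ≥ n / p - 1`; the lost `1` per prime costs Chebyshev's `θ(n) ≤ n log 4`.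
  have hup : n * ∑ p ∈ primesUpTo n, Real.log p / p ≤ n * Real.log n + Real.log 4 * n := by
    refine le_trans ?_ (add_le_add (log_factorial_le n) (sum_primesUpTo_log_le n))
    rw [heq, ← Finset.sum_add_distrib, Finset.mul_sum]
    refine Finset.sum_le_sum fun p hp => ?_
    have hpp := (mem_primesUpTo.1 hp).2
    have h1 : ((n / p : ℕ) : ℝ) ≤ n.factorial.factorization p := by
      rw [Nat.factorization_factorial hpp (show Nat.log p n < Nat.log p n + 2 by omega)]
      have h := Finset.single_le_sum (f := fun i => n / p ^ i) (fun i _ => Nat.zero_le _)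
        (show 1 ∈ Finset.Ico 1 (Nat.log p n + 2) by simp)
      rw [pow_one] at h
      exact_mod_cast h
    have h2 : (n : ℝ) / p ≤ (n / p : ℕ) + 1 := by
      rw [← Nat.floor_div_eq_div (K := ℝ)]
      exact (Nat.lt_floor_add_one _).le
    have := hlog p hp
    calc n * (Real.log p / p) = (n / p : ℝ) * Real.log p := by ring
      _ ≤ (n.factorial.factorization p + 1) * Real.log p := by gcongr; linarith
      _ = _ := by ring
  have hlo : n * Real.log n - n ≤ n * (∑ p ∈ primesUpTo n, Real.log p / p + K) := by
    refine (le_log_factorial n).trans ?_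
    have : ∑ p ∈ primesUpTo n, Real.log p / p + K ≥
        ∑ p ∈ primesUpTo n, (Real.log p / p + Real.log p / (p * (p - 1))) := by
      rw [Finset.sum_add_distrib]; linarith [hK n]
    refine le_trans ?_ (mul_le_mul_of_nonneg_left this hn'.le)
    rw [heq, Finset.mul_sum]
    refine Finset.sum_le_sum fun p hp => ?_
    have hpp := (mem_primesUpTo.1 hp).2
    have h2 := htwo p hp
    have hq : (n.factorial.factorization p : ℝ) ≤ n / (p - 1) := by
      refine le_trans (Nat.cast_le.2 (Nat.factorization_factorial_le_div_pred hpp n)) ?_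
      refine Nat.cast_div_le.trans ?_
      rw [Nat.cast_sub hpp.one_le, Nat.cast_one]
    have := hlog p hp
    have hp1 : (p : ℝ) - 1 ≠ 0 := by linarith
    have hp0 : (p : ℝ) ≠ 0 := by linarith
    calc (n.factorial.factorization p : ℝ) * Real.log p ≤ n / (p - 1) * Real.log p := by gcongr
      _ = _ := by field_simp; ring
  rw [abs_le]
  have hup' : ∑ p ∈ primesUpTo n, Real.log p / p ≤ Real.log n + Real.log 4 := by
    nlinarith
  have hlo' : Real.log n - 1 ≤ ∑ p ∈ primesUpTo n, Real.log p / p + K := by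
    nlinarith
  constructor <;> linarith

/-! ### Mertens' second theorem, by partial summation. -/

/-- Abel's inequality: a series with bounded partial sums, weighted by a nonnegative antitone
sequence. -/
theorem abs_sum_mul_le_of_antitone {c g : ℕ → ℝ} {K : ℝ} {a : ℕ}
    (hc : ∀ n, a ≤ n → |∑ k ∈ Finset.Icc a n, c k| ≤ K) (hg0 : ∀ n, a ≤ n → 0 ≤ g n)
    (hg : ∀ n, a ≤ n → g (n + 1) ≤ g n) {n : ℕ} (hn : a ≤ n) :
    |∑ k ∈ Finset.Icc a n, c k * g k| ≤ K * g a := by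
  -- Subtracting the boundary term leaves only increments `(partial sum) * (g n - g (n + 1))`, whose
  -- bounds telescope.
  have key : |∑ k ∈ Finset.Icc a n, c k * g k - (∑ k ∈ Finset.Icc a n, c k) * g n|
      ≤ K * (g a - g n) := by
    induction n, hn using Nat.le_induction with
    | base => simp
    | succ n hn ih =>
      rw [← Finset.insert_Icc_right_eq_Icc_add_one (by omega : a ≤ n + 1),
        Finset.sum_insert (by simp), Finset.sum_insert (by simp)]
      have h1 : |(∑ k ∈ Finset.Icc a n, c k) * (g n - g (n + 1))| ≤ K * (g n - g (n + 1)) := by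
        rw [abs_mul, abs_of_nonneg (sub_nonneg.2 (hg n hn))]
        exact mul_le_mul_of_nonneg_right (hc n hn) (sub_nonneg.2 (hg n hn))
      have h2 := abs_add_le _ _ |>.trans (add_le_add ih h1)
      calc _ = |(∑ k ∈ Finset.Icc a n, c k * g k - (∑ k ∈ Finset.Icc a n, c k) * g n) +
              (∑ k ∈ Finset.Icc a n, c k) * (g n - g (n + 1))| := by congr 1; ring
        _ ≤ _ := h2
        _ = _ := by ring
  have h3 : |(∑ k ∈ Finset.Icc a n, c k) * g n| ≤ K * g n := by
    rw [abs_mul, abs_of_nonneg (hg0 n hn)]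
    exact mul_le_mul_of_nonneg_right (hc n hn) (hg0 n hn)
  calc _ = |(∑ k ∈ Finset.Icc a n, c k * g k - (∑ k ∈ Finset.Icc a n, c k) * g n) +
              (∑ k ∈ Finset.Icc a n, c k) * g n| := by congr 1; ring
    _ ≤ _ := abs_add_le _ _
    _ ≤ K * (g a - g n) + K * g n := add_le_add key h3
    _ = _ := by ring

theorem log_log_succ_sub_le {x : ℝ} (hx : 2 ≤ x) :
    Real.log (Real.log (x + 1)) - Real.log (Real.log x) ≤ 1 / (x * Real.log x) := by
  have hl : 0 < Real.log x := Real.log_pos (by linarith)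
  have hl' : 0 < Real.log (x + 1) := Real.log_pos (by linarith)
  rw [← Real.log_div hl'.ne' hl.ne']
  refine (Real.log_le_sub_one_of_pos (by positivity)).trans ?_
  have h : Real.log (x + 1) - Real.log x ≤ 1 / x := by
    rw [← Real.log_div (by linarith) (by linarith)]
    refine (Real.log_le_sub_one_of_pos (by positivity)).trans (le_of_eq ?_)
    field_simp; ring
  calc Real.log (x + 1) / Real.log x - 1 = (Real.log (x + 1) - Real.log x) / Real.log x := by
        field_simp
    _ ≤ (1 / x) / Real.log x := by gcongr
    _ = _ := by field_simp

theorem one_div_mul_log_le_log_log_sub {x : ℝ} (hx : 2 ≤ x) :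
    1 / ((x + 1) * Real.log (x + 1)) ≤ Real.log (Real.log (x + 1)) - Real.log (Real.log x) := by
  have hl : 0 < Real.log x := Real.log_pos (by linarith)
  have hl' : 0 < Real.log (x + 1) := Real.log_pos (by linarith)
  have h1 := Real.log_le_sub_one_of_pos (show 0 < Real.log x / Real.log (x + 1) by positivity)
  rw [Real.log_div hl.ne' hl'.ne'] at h1
  have h2 := Real.log_le_sub_one_of_pos (show 0 < x / (x + 1) by positivity)
  rw [Real.log_div (by linarith) (by linarith)] at h2
  have h3 : x / (x + 1) - 1 = - (1 / (x + 1)) := by field_simp; ring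
  calc 1 / ((x + 1) * Real.log (x + 1)) = (1 / (x + 1)) / Real.log (x + 1) := by field_simp
    _ ≤ (Real.log (x + 1) - Real.log x) / Real.log (x + 1) := by gcongr; linarith
    _ = 1 - Real.log x / Real.log (x + 1) := by field_simp
    _ ≤ _ := by linarith

theorem exists_abs_sum_inv_mul_log_sub_log_log_le :
    ∃ K : ℝ, ∀ n : ℕ, 2 ≤ n →
      |∑ k ∈ Finset.Icc 2 n, 1 / ((k : ℝ) * Real.log k) - Real.log (Real.log n)| ≤ K := by
  -- The sum minus `log log n` decreases in `n`, and becomes increasing once its last term is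
  -- removed.
  have key : ∀ n : ℕ, 2 ≤ n →
      -Real.log (Real.log 2) ≤
        ∑ k ∈ Finset.Icc 2 n, 1 / ((k : ℝ) * Real.log k) - Real.log (Real.log n) -
          1 / ((n : ℝ) * Real.log n) ∧
      ∑ k ∈ Finset.Icc 2 n, 1 / ((k : ℝ) * Real.log k) - Real.log (Real.log n) ≤
        1 / (2 * Real.log 2) - Real.log (Real.log 2) := by
    intro n hn
    induction n, hn using Nat.le_induction with
    | base => simp
    | succ n hn ih =>
      rw [← Finset.insert_Icc_right_eq_Icc_add_one (by omega : 2 ≤ n + 1),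
        Finset.sum_insert (by simp)]
      have h2 : (2 : ℝ) ≤ n := by exact_mod_cast hn
      have h3 := log_log_succ_sub_le h2
      have h4 := one_div_mul_log_le_log_log_sub h2
      push_cast
      constructor <;> linarith [ih.1, ih.2]
  refine ⟨1 / (2 * Real.log 2) + |Real.log (Real.log 2)|, fun n hn => ?_⟩
  have h1 : 0 < Real.log 2 := Real.log_pos (by norm_num)
  have h0 : 0 < 1 / (2 * Real.log 2) := by positivity
  have h2 : 0 ≤ 1 / ((n : ℝ) * Real.log n) := by
    have := Real.log_natCast_nonneg n
    positivity
  have := key n hn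
  have h5 := neg_abs_le (Real.log (Real.log 2))
  have h6 := le_abs_self (Real.log (Real.log 2))
  rw [abs_le]
  constructor <;> linarith

/-- Mertens' second theorem, at natural arguments. -/
theorem exists_abs_sum_inv_sub_log_log_natCast_le :
    ∃ K : ℝ, ∀ n : ℕ, 2 ≤ n →
      |∑ p ∈ primesUpTo n, 1 / (p : ℝ) - Real.log (Real.log n)| ≤ K := by
  obtain ⟨K₁, -, hK₁⟩ := exists_abs_sum_log_div_sub_log_le
  obtain ⟨K₂, hK₂⟩ := exists_abs_sum_inv_mul_log_sub_log_log_le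
  -- Mertens' first theorem and the harmonic sum both have main term `log n`, so the partial sums of
  -- `c` are bounded; the weight `g` turns the two pieces into `1 / p` and `1 / (k log k)`.
  let c : ℕ → ℝ := fun k => (if k.Prime then Real.log k / k else 0) - 1 / k
  let g : ℕ → ℝ := fun k => 1 / Real.log k
  have hfilter : ∀ n, primesUpTo n = {p ∈ Finset.Icc 2 n | p.Prime} := by
    intro n
    ext p
    simp only [mem_primesUpTo, Finset.mem_filter, Finset.mem_Icc]
    exact ⟨fun h => ⟨⟨h.2.two_le, h.1⟩, h.2⟩, fun h => ⟨h.1.2, h.2⟩⟩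
  have hlogpos : ∀ k : ℕ, 2 ≤ k → 0 < Real.log (k : ℝ) := fun k hk =>
    Real.log_pos (by exact_mod_cast hk)
  have hc : ∀ n, 2 ≤ n → |∑ k ∈ Finset.Icc 2 n, c k| ≤ K₁ + 2 := by
    intro n hn
    have hn0 : (0 : ℝ) < n := by exact_mod_cast (by omega : 0 < n)
    have h1 := hK₁ n (by omega)
    have h2 : Real.log n ≤ ∑ k ∈ Finset.Icc 2 n, 1 / (k : ℝ) + 1 ∧
        ∑ k ∈ Finset.Icc 2 n, 1 / (k : ℝ) ≤ Real.log n := by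
      have hh : ((harmonic n : ℚ) : ℝ) = 1 + ∑ k ∈ Finset.Icc 2 n, 1 / (k : ℝ) := by
        rw [harmonic_eq_sum_Icc, ← Finset.insert_Icc_add_one_left_eq_Icc (by omega : 1 ≤ n),
          Finset.sum_insert (by simp)]
        push_cast
        simp
      have ha := log_add_one_le_harmonic n
      have hb := harmonic_le_one_add_log n
      rw [hh] at ha hb
      have : Real.log n ≤ Real.log ((n + 1 : ℕ) : ℝ) :=
        Real.log_le_log hn0 (by push_cast; linarith)
      constructor <;> linarith
    simp only [c]
    rw [Finset.sum_sub_distrib, ← Finset.sum_filter, ← hfilter]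
    rw [abs_le] at h1 ⊢
    constructor <;> linarith [h1.1, h1.2, h2.1, h2.2]
  have hg0 : ∀ n, 2 ≤ n → 0 ≤ g n := fun n hn => by
    have := hlogpos n hn
    simp only [g]; positivity
  have hg : ∀ n, 2 ≤ n → g (n + 1) ≤ g n := fun n hn => by
    have h1 := hlogpos n hn
    have h0 : (0 : ℝ) < n := by exact_mod_cast (by omega : 0 < n)
    simp only [g]
    refine one_div_le_one_div_of_le h1 (Real.log_le_log h0 ?_)
    push_cast; linarith
  refine ⟨(K₁ + 2) * g 2 + K₂, fun n hn => ?_⟩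
  have h1 := abs_sum_mul_le_of_antitone hc hg0 hg hn
  have h2 := hK₂ n hn
  have h3 : ∑ k ∈ Finset.Icc 2 n, c k * g k =
      ∑ p ∈ primesUpTo n, 1 / (p : ℝ) - ∑ k ∈ Finset.Icc 2 n, 1 / ((k : ℝ) * Real.log k) := by
    rw [hfilter, Finset.sum_filter, ← Finset.sum_sub_distrib]
    refine Finset.sum_congr rfl fun k hk => ?_
    have hl := hlogpos k (Finset.mem_Icc.1 hk).1
    simp only [c, g]
    split_ifs
    · field_simp
    · field_simp
      ring
  rw [h3] at h1
  refine le_trans ?_ ((abs_add_le _ _).trans (add_le_add h1 h2))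
  apply le_of_eq
  congr 1
  ring

/-- Mertens' second theorem. -/
theorem exists_abs_sum_inv_sub_log_log_le :
    ∃ K : ℝ, 0 ≤ K ∧ ∀ x : ℝ, 2 ≤ x →
      |∑ p ∈ primesUpTo ⌊x⌋₊, 1 / (p : ℝ) - Real.log (Real.log x)| ≤ K := by
  obtain ⟨K, hK⟩ := exists_abs_sum_inv_sub_log_log_natCast_le
  have hl2 : 0 < Real.log 2 := Real.log_pos (by norm_num)
  have hK0 : 0 ≤ K := (abs_nonneg _).trans (hK 2 le_rfl)
  refine ⟨K + 1 / (2 * Real.log 2), by positivity, fun x hx => ?_⟩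
  have hn : 2 ≤ ⌊x⌋₊ := Nat.le_floor (by exact_mod_cast hx)
  have hn' : (2 : ℝ) ≤ ⌊x⌋₊ := by exact_mod_cast hn
  have hlog : Real.log 2 ≤ Real.log ⌊x⌋₊ := Real.log_le_log (by norm_num) hn'
  have h1 : Real.log (Real.log ⌊x⌋₊) ≤ Real.log (Real.log x) :=
    Real.log_le_log (by linarith)
      (Real.log_le_log (by linarith) (Nat.floor_le (by linarith)))
  have h2 : Real.log (Real.log x) ≤ Real.log (Real.log (⌊x⌋₊ + 1)) :=
    Real.log_le_log (Real.log_pos (by linarith))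
      (Real.log_le_log (by linarith) (Nat.lt_floor_add_one x).le)
  have h3 := log_log_succ_sub_le hn'
  have h4 : 1 / ((⌊x⌋₊ : ℝ) * Real.log ⌊x⌋₊) ≤ 1 / (2 * Real.log 2) := by
    gcongr
  have h5 := hK _ hn
  rw [abs_le] at h5 ⊢
  have : 0 < 1 / (2 * Real.log 2) := by positivity
  constructor <;> linarith [h5.1, h5.2]

/-! ### Mean values of multiplicative functions over squarefree integers. -/

theorem mem_squarefreeUpTo {N : ℝ} {D : ℕ} :
    D ∈ squarefreeUpTo N ↔ (D ≠ 0 ∧ D ≤ ⌊N⌋₊) ∧ Squarefree D := by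
  simp [squarefreeUpTo, Nat.one_le_iff_ne_zero]

theorem log_eq_sum_primeFactors_of_squarefree {D : ℕ} (hD : Squarefree D) :
    Real.log D = ∑ p ∈ D.primeFactors, Real.log p := by
  conv_lhs => rw [← Nat.prod_primeFactors_of_squarefree hD]
  push_cast
  rw [Real.log_prod]
  intro p hp
  exact_mod_cast (Nat.prime_of_mem_primeFactors hp).ne_zero

/-- A squarefree `D` is determined by its set of primes, so the sum is part of the expansion of `∏
(1 + g p / p)`; then `1 + t ≤ exp t`. -/
theorem sum_prod_primeFactors_div_le {g : ℕ → ℝ} (hg : ∀ p, 0 ≤ g p) (N : ℝ) :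
    ∑ D ∈ squarefreeUpTo N, (∏ p ∈ D.primeFactors, g p) / D ≤
      Real.exp (∑ p ∈ primesUpTo ⌊N⌋₊, g p / p) := by
  have hterm : ∀ D ∈ squarefreeUpTo N,
      (∏ p ∈ D.primeFactors, g p) / (D : ℝ) = ∏ p ∈ D.primeFactors, g p / p := by
    intro D hD
    rw [Finset.prod_div_distrib]
    congr 1
    conv_lhs => rw [← Nat.prod_primeFactors_of_squarefree (mem_squarefreeUpTo.1 hD).2]
    push_cast
    rfl
  have hnn : ∀ p, 0 ≤ g p / (p : ℝ) := fun p => div_nonneg (hg p) (Nat.cast_nonneg p)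
  have hinj : Set.InjOn Nat.primeFactors (squarefreeUpTo N : Set ℕ) := by
    intro D hD E hE h
    rw [← Nat.prod_primeFactors_of_squarefree (mem_squarefreeUpTo.1 hD).2, h,
      Nat.prod_primeFactors_of_squarefree (mem_squarefreeUpTo.1 hE).2]
  rw [Finset.sum_congr rfl hterm,
    ← Finset.sum_image (f := fun s : Finset ℕ => ∏ p ∈ s, g p / (p : ℝ)) hinj]
  have hsub : (squarefreeUpTo N).image Nat.primeFactors ⊆ (primesUpTo ⌊N⌋₊).powerset := by
    intro s hs
    obtain ⟨D, hD, rfl⟩ := Finset.mem_image.1 hs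
    rw [Finset.mem_powerset]
    intro p hp
    have hD' := mem_squarefreeUpTo.1 hD
    exact mem_primesUpTo.2 ⟨(Nat.le_of_mem_primeFactors hp).trans hD'.1.2,
      Nat.prime_of_mem_primeFactors hp⟩
  refine (Finset.sum_le_sum_of_subset_of_nonneg hsub
    fun s _ _ => Finset.prod_nonneg fun p _ => hnn p).trans ?_
  rw [← Finset.prod_one_add, Real.exp_sum]
  refine Finset.prod_le_prod (fun p _ => by linarith [hnn p]) fun p _ => ?_
  rw [add_comm]
  exact Real.add_one_le_exp _

/-- Expand `log D = ∑ log p` over `p ∣ D` and write `D = m * p`. As `g ≤ 1`, passing from `D` to `m`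
does not decrease the product, and the sum over `p ≤ N / m` is at most `log 4 * N / m`. -/
theorem sum_prod_primeFactors_mul_log_le {g : ℕ → ℝ} (hg : ∀ p, 0 ≤ g p) (hg1 : ∀ p, g p ≤ 1)
    {N : ℝ} (hN : 0 ≤ N) :
    ∑ D ∈ squarefreeUpTo N, (∏ p ∈ D.primeFactors, g p) * Real.log D ≤
      Real.log 4 * N * ∑ D ∈ squarefreeUpTo N, (∏ p ∈ D.primeFactors, g p) / D := by
  set f : ℕ → ℝ := fun D => ∏ p ∈ D.primeFactors, g p with hf
  have hf0 : ∀ D, 0 ≤ f D := fun D => Finset.prod_nonneg fun p _ => hg p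
  let s : Finset (Σ _ : ℕ, ℕ) := (squarefreeUpTo N).sigma fun D => D.primeFactors
  let t : Finset (Σ _ : ℕ, ℕ) := (squarefreeUpTo N).sigma fun m => primesUpTo (⌊N⌋₊ / m)
  let i : (Σ _ : ℕ, ℕ) → Σ _ : ℕ, ℕ := fun x => ⟨x.1 / x.2, x.2⟩
  have hs : ∀ x ∈ s, x.1 ∈ squarefreeUpTo N ∧ x.2.Prime ∧ x.2 ∣ x.1 := by
    intro x hx
    have h := Finset.mem_sigma.1 hx
    exact ⟨h.1, Nat.prime_of_mem_primeFactors h.2, Nat.dvd_of_mem_primeFactors h.2⟩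
  have hinj : Set.InjOn i (s : Set (Σ _ : ℕ, ℕ)) := by
    rintro ⟨D, p⟩ hx ⟨E, q⟩ hy h
    obtain ⟨-, -, h1⟩ := hs _ hx
    obtain ⟨-, -, h2⟩ := hs _ hy
    simp only [i, Sigma.mk.injEq, heq_eq_eq] at h
    obtain ⟨h3, rfl⟩ := h
    have : D = E := by
      exact (Nat.div_left_inj h1 h2).1 h3
    rw [this]
  have hmaps : s.image i ⊆ t := by
    intro y hy
    obtain ⟨⟨D, p⟩, hx, rfl⟩ := Finset.mem_image.1 hy
    obtain ⟨h1, hp, m, h2⟩ := hs _ hx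
    simp only at h1 hp h2
    obtain ⟨⟨h3, h4⟩, h5⟩ := mem_squarefreeUpTo.1 h1
    subst h2
    have hm : m ≠ 0 := right_ne_zero_of_mul h3
    simp only [i, t, Finset.mem_sigma, Nat.mul_div_cancel_left m hp.pos]
    refine ⟨mem_squarefreeUpTo.2 ⟨⟨hm, ?_⟩, h5.of_mul_right⟩, mem_primesUpTo.2 ⟨?_, hp⟩⟩
    · exact (Nat.le_mul_of_pos_left m hp.pos).trans h4
    · exact (Nat.le_div_iff_mul_le (Nat.pos_of_ne_zero hm)).2 h4
  have hterm : ∀ x ∈ s, f x.1 * Real.log x.2 ≤ f (i x).1 * Real.log (i x).2 := by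
    rintro ⟨D, p⟩ hx
    obtain ⟨h1, hp, h2⟩ := hs _ hx
    refine mul_le_mul_of_nonneg_right ?_ (Real.log_natCast_nonneg _)
    have hsub : (D / p).primeFactors ⊆ D.primeFactors :=
      Nat.primeFactors_mono (Nat.div_dvd_of_dvd h2) (mem_squarefreeUpTo.1 h1).1.1
    simp only [hf]
    rw [← Finset.prod_sdiff hsub]
    exact mul_le_of_le_one_left (hf0 _) (Finset.prod_le_one (fun p _ => hg p) fun p _ => hg1 p)
  calc ∑ D ∈ squarefreeUpTo N, f D * Real.log D
      = ∑ D ∈ squarefreeUpTo N, ∑ p ∈ D.primeFactors, f D * Real.log p := by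
        refine Finset.sum_congr rfl fun D hD => ?_
        rw [log_eq_sum_primeFactors_of_squarefree (mem_squarefreeUpTo.1 hD).2, Finset.mul_sum]
    _ = ∑ x ∈ s, f x.1 * Real.log x.2 := Finset.sum_sigma' _ _ _
    _ ≤ ∑ x ∈ s, f (i x).1 * Real.log (i x).2 := Finset.sum_le_sum hterm
    _ = ∑ y ∈ s.image i, f y.1 * Real.log y.2 :=
        (Finset.sum_image (f := fun y : (Σ _ : ℕ, ℕ) => f y.1 * Real.log y.2) hinj).symm
    _ ≤ ∑ y ∈ t, f y.1 * Real.log y.2 :=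
        Finset.sum_le_sum_of_subset_of_nonneg hmaps fun y _ _ =>
          mul_nonneg (hf0 _) (Real.log_natCast_nonneg _)
    _ = ∑ m ∈ squarefreeUpTo N, ∑ p ∈ primesUpTo (⌊N⌋₊ / m), f m * Real.log p :=
        Finset.sum_sigma _ _ _
    _ ≤ ∑ m ∈ squarefreeUpTo N, Real.log 4 * N * (f m / m) := by
        refine Finset.sum_le_sum fun m hm => ?_
        rw [← Finset.mul_sum]
        have h4 : 0 ≤ Real.log 4 := Real.log_nonneg (by norm_num)
        have h5 : ((⌊N⌋₊ / m : ℕ) : ℝ) ≤ N / m :=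
          Nat.cast_div_le.trans (by gcongr; exact Nat.floor_le hN)
        calc f m * ∑ p ∈ primesUpTo (⌊N⌋₊ / m), Real.log p
            ≤ f m * (Real.log 4 * (N / m)) := by
              refine mul_le_mul_of_nonneg_left ?_ (hf0 m)
              exact (sum_primesUpTo_log_le _).trans (by gcongr)
          _ = _ := by ring
    _ = _ := (Finset.mul_sum _ _ _).symm

/-- The Hall–Tenenbaum upper bound for sums over squarefree integers of a multiplicative function
with values in `[0, 1]`. -/
theorem log_mul_sum_prod_primeFactors_le {g : ℕ → ℝ} (hg : ∀ p, 0 ≤ g p) (hg1 : ∀ p, g p ≤ 1)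
    {N : ℝ} (hN : 1 < N) :
    Real.log N * ∑ D ∈ squarefreeUpTo N, ∏ p ∈ D.primeFactors, g p ≤
      (1 + Real.log 4) * N * Real.exp (∑ p ∈ primesUpTo ⌊N⌋₊, g p / p) := by
  have hN0 : 0 < N := by linarith
  have h4 : 0 ≤ Real.log 4 := Real.log_nonneg (by norm_num)
  have h1 := sum_prod_primeFactors_mul_log_le hg hg1 hN0.le
  have h2 := sum_prod_primeFactors_div_le hg N
  have h3 : Real.log N * ∑ D ∈ squarefreeUpTo N, ∏ p ∈ D.primeFactors, g p ≤
      ∑ D ∈ squarefreeUpTo N, (∏ p ∈ D.primeFactors, g p) * Real.log D +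
        N * ∑ D ∈ squarefreeUpTo N, (∏ p ∈ D.primeFactors, g p) / D := by
    rw [Finset.mul_sum, Finset.mul_sum, ← Finset.sum_add_distrib]
    refine Finset.sum_le_sum fun D hD => ?_
    have hD0 : (0 : ℝ) < D := by
      exact_mod_cast Nat.pos_of_ne_zero (mem_squarefreeUpTo.1 hD).1.1
    have hf : 0 ≤ ∏ p ∈ D.primeFactors, g p := Finset.prod_nonneg fun p _ => hg p
    -- `log (N / D) ≤ N / D` trades the weight `log N` for `log D`.
    have hlog : Real.log N ≤ Real.log D + N / D := by
      have := Real.log_le_sub_one_of_pos (show 0 < N / D by positivity)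
      rw [Real.log_div hN0.ne' hD0.ne'] at this
      linarith
    calc _ ≤ (Real.log D + N / D) * ∏ p ∈ D.primeFactors, g p := by gcongr
      _ = _ := by ring
  calc _ ≤ (1 + Real.log 4) * N *
        ∑ D ∈ squarefreeUpTo N, (∏ p ∈ D.primeFactors, g p) / D := by linarith
    _ ≤ _ := by gcongr

/-! ### Reciprocal mass of the medium primes. -/

/-- Membership of `p` in the range `ε log log N < log log p < (1 - ε) log log N`. -/
def IsMedium (ε N : ℝ) (p : ℕ) : Prop :=
  ε * Real.log (Real.log N) < Real.log (Real.log (p : ℝ)) ∧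
    Real.log (Real.log (p : ℝ)) < (1 - ε) * Real.log (Real.log N)

open Classical in
theorem exists_le_sum_inv_medium :
    ∃ K : ℝ, 0 ≤ K ∧ ∀ ε N : ℝ, 0 ≤ ε → 2 * ε ≤ 1 → Real.exp 1 ≤ N →
      (1 - 2 * ε) * Real.log (Real.log N) - K ≤
        ∑ p ∈ primesUpTo ⌊N⌋₊ with IsMedium ε N p, 1 / (p : ℝ) := by
  obtain ⟨K, hK0, hK⟩ := exists_abs_sum_inv_sub_log_log_le
  refine ⟨2 * K + 1, by positivity, fun ε N hε hε2 hN => ?_⟩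
  set L := Real.log (Real.log N) with hL
  have hN0 : 0 < N := (Real.exp_pos 1).trans_le hN
  have hlogN : 1 ≤ Real.log N := (Real.le_log_iff_exp_le hN0).2 hN
  have hL0 : 0 ≤ L := Real.log_nonneg hlogN
  have hNeq : N = Real.exp (Real.exp L) := by
    rw [hL, Real.exp_log (by linarith), Real.exp_log hN0]
  have htwo : ∀ a : ℝ, 0 ≤ a → 2 ≤ Real.exp (Real.exp a) := fun a ha => by
    have h1 := Real.add_one_le_exp a
    have h2 := Real.add_one_le_exp (Real.exp a)
    linarith
  have ha : 0 ≤ ε * L := by positivity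
  have hb : 0 ≤ (1 - ε) * L := mul_nonneg (by linarith) hL0
  set y := Real.exp (Real.exp (ε * L)) with hy
  set w := Real.exp (Real.exp ((1 - ε) * L)) with hw
  have hy2 : 2 ≤ y := htwo _ ha
  have hw2 : 2 ≤ w := htwo _ hb
  have hwN : w ≤ N := by
    rw [hNeq, hw]
    gcongr
    nlinarith
  have hsy := hK y hy2
  have hsw := hK w hw2
  rw [hy, Real.log_exp, Real.log_exp, ← hy, abs_le] at hsy
  rw [hw, Real.log_exp, Real.log_exp, ← hw, abs_le] at hsw
  -- The upper inequality in `IsMedium` is strict, so a prime equal to `w` must be added by hand;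
  -- its reciprocal accounts for the `+ 1` in the constant.
  have hsub : primesUpTo ⌊w⌋₊ ⊆
      (primesUpTo ⌊y⌋₊ ∪ {p ∈ primesUpTo ⌊N⌋₊ | IsMedium ε N p}) ∪ {⌊w⌋₊} := by
    intro p hp
    obtain ⟨hpw, hpp⟩ := mem_primesUpTo.1 hp
    have hpw' : (p : ℝ) ≤ w := (Nat.le_floor_iff (by linarith)).1 hpw
    have hp1 : (1 : ℝ) < p := by exact_mod_cast hpp.one_lt
    have hlogp : 0 < Real.log p := Real.log_pos hp1
    simp only [Finset.mem_union, Finset.mem_singleton, Finset.mem_filter]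
    by_cases hpy : (p : ℝ) ≤ y
    · exact Or.inl (Or.inl (mem_primesUpTo.2 ⟨Nat.le_floor hpy, hpp⟩))
    rcases hpw'.lt_or_eq with hlt | heq
    · refine Or.inl (Or.inr ⟨mem_primesUpTo.2 ⟨Nat.le_floor (hpw'.trans hwN), hpp⟩, ?_, ?_⟩)
      · rw [Real.lt_log_iff_exp_lt hlogp, Real.lt_log_iff_exp_lt (by linarith)]
        exact not_le.1 hpy
      · rw [Real.log_lt_iff_lt_exp hlogp, Real.log_lt_iff_lt_exp (by linarith)]
        exact hlt
    · right
      rw [← heq, Nat.floor_natCast]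
  have hnn : ∀ p : ℕ, 0 ≤ 1 / (p : ℝ) := fun p => by positivity
  have hsum : ∑ p ∈ primesUpTo ⌊w⌋₊, 1 / (p : ℝ) ≤
      ∑ p ∈ primesUpTo ⌊y⌋₊, 1 / (p : ℝ) +
        ∑ p ∈ primesUpTo ⌊N⌋₊ with IsMedium ε N p, 1 / (p : ℝ) + 1 := by
    refine (Finset.sum_le_sum_of_subset_of_nonneg hsub fun p _ _ => hnn p).trans ?_
    have hunion : ∀ s t : Finset ℕ, ∑ p ∈ s ∪ t, 1 / (p : ℝ) ≤
        ∑ p ∈ s, 1 / (p : ℝ) + ∑ p ∈ t, 1 / (p : ℝ) := fun s t => by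
      rw [← Finset.sum_union_inter]
      linarith [Finset.sum_nonneg fun p (_ : p ∈ s ∩ t) => hnn p]
    refine (hunion _ _).trans (add_le_add (hunion _ _) ?_)
    rw [Finset.sum_singleton]
    have : (1 : ℝ) ≤ ⌊w⌋₊ := by
      exact_mod_cast Nat.le_floor (by push_cast; linarith : ((1 : ℕ) : ℝ) ≤ w)
    exact (div_le_one (by linarith)).2 this
  nlinarith [hsy.1, hsy.2, hsw.1, hsw.2]

/-! ### Rankin's bound and the conclusion. -/

theorem card_exceptionalSet_le (ε lam : ℝ) {N : ℝ} (hN : 0 ≤ N) :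
    ((exceptionalSet ε lam N).card : ℝ) ≤ N := by
  have h : (exceptionalSet ε lam N).card ≤ ⌊N⌋₊ := by
    refine (Finset.card_le_card ((Finset.filter_subset _ _).trans
      (Finset.filter_subset _ _))).trans ?_
    simp
  exact (Nat.cast_le.2 h).trans (Nat.floor_le hN)

open Classical in
theorem card_exceptionalSet_le_rpow_mul_sum {ε lam z N : ℝ} (hz : 0 < z) (hz1 : z ≤ 1) :
    ((exceptionalSet ε lam N).card : ℝ) ≤ z ^ (-(lam * Real.log (Real.log N))) *
      ∑ D ∈ squarefreeUpTo N, ∏ p ∈ D.primeFactors, if IsMedium ε N p then z else 1 := by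
  have hprod : ∀ D : ℕ, (∏ p ∈ D.primeFactors, if IsMedium ε N p then z else 1) =
      z ^ ((mediumPrimeFactors ε N D).card : ℝ) := by
    intro D
    rw [← Finset.prod_filter, Finset.prod_const, Real.rpow_natCast]
    congr 2
    simp only [mediumPrimeFactors, IsMedium]
    congr
  rw [Finset.mul_sum, Finset.card_eq_sum_ones]
  push_cast
  refine le_trans (Finset.sum_le_sum fun D hD => ?_)
    (Finset.sum_le_sum_of_subset_of_nonneg (Finset.filter_subset _ _) fun D _ _ => ?_)
  · rw [hprod, ← Real.rpow_add hz]
    refine Real.one_le_rpow_of_pos_of_le_one_of_nonpos hz hz1 ?_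
    have := not_le.1 (Finset.mem_filter.1 hD).2
    linarith
  · rw [hprod]
    positivity

theorem lemma4p2 (ε lam : ℝ) (hε : 0 < ε) (hlam : 0 < lam) (hlt : lam < 1 - 2 * ε) :
    ∃ C : ℝ, 0 < C ∧ ∀ N : ℝ, 1 < N →
      ((exceptionalSet ε lam N).card : ℝ) ≤
        C * (N * Real.exp (-((lam * Real.log (lam / (1 - 2 * ε)) - lam + (1 - 2 * ε))
          * Real.log (Real.log N)))) := by
  classical
  obtain ⟨K₁, hK₁0, hK₁⟩ := exists_abs_sum_inv_sub_log_log_le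
  obtain ⟨K₂, hK₂0, hK₂⟩ := exists_le_sum_inv_medium
  have hκ : 0 < 1 - 2 * ε := hlam.trans hlt
  set z := lam / (1 - 2 * ε) with hzdef
  have hz : 0 < z := by positivity
  have hz1 : z < 1 := (div_lt_one hκ).2 hlt
  have hzκ : z * (1 - 2 * ε) = lam := div_mul_cancel₀ _ hκ.ne'
  have h4 : 0 ≤ Real.log 4 := Real.log_nonneg (by norm_num)
  -- This is `log (1 / z) ≤ 1 / z - 1` multiplied by `lam`.
  have hrate : 0 ≤ lam * Real.log z - lam + (1 - 2 * ε) := by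
    have h := Real.log_le_sub_one_of_pos (inv_pos.2 hz)
    rw [Real.log_inv] at h
    have h' : lam * z⁻¹ = 1 - 2 * ε := by rw [hzdef]; field_simp
    nlinarith
  have hC : 1 ≤ (1 + Real.log 4) * Real.exp (K₁ + K₂) := by
    have := Real.one_le_exp (show 0 ≤ K₁ + K₂ by positivity)
    nlinarith
  refine ⟨(1 + Real.log 4) * Real.exp (K₁ + K₂), by positivity, fun N hN => ?_⟩
  have hN0 : 0 < N := by linarith
  have hlogN : 0 < Real.log N := Real.log_pos hN
  set L := Real.log (Real.log N) with hL
  -- For `N < e` one has `L ≤ 0`, so the exponential is at least `1` and the trivial count `≤ N`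
  -- suffices.
  rcases lt_or_ge N (Real.exp 1) with hsmall | hlarge
  · have hL0 : L ≤ 0 := Real.log_nonpos hlogN.le
      ((Real.log_lt_iff_lt_exp hN0).2 hsmall).le
    have hexp : 1 ≤ Real.exp (-((lam * Real.log z - lam + (1 - 2 * ε)) * L)) :=
      Real.one_le_exp (by nlinarith)
    calc ((exceptionalSet ε lam N).card : ℝ) ≤ 1 * (N * 1) := by
          simpa using card_exceptionalSet_le ε lam hN0.le
      _ ≤ _ := by gcongr
  set g : ℕ → ℝ := fun p => if IsMedium ε N p then z else 1 with hg
  have hg0 : ∀ p, 0 ≤ g p := fun p => by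
    simp only [hg]; split_ifs <;> linarith
  have hg1 : ∀ p, g p ≤ 1 := fun p => by
    simp only [hg]; split_ifs <;> linarith
  have hsum : ∑ p ∈ primesUpTo ⌊N⌋₊, g p / p ≤
      L + (K₁ + K₂) - (1 - z) * ((1 - 2 * ε) * L) := by
    have hsplit : ∑ p ∈ primesUpTo ⌊N⌋₊, g p / p = ∑ p ∈ primesUpTo ⌊N⌋₊, 1 / (p : ℝ) -
        (1 - z) * ∑ p ∈ primesUpTo ⌊N⌋₊ with IsMedium ε N p, 1 / (p : ℝ) := by
      rw [Finset.sum_filter, Finset.mul_sum, ← Finset.sum_sub_distrib]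
      refine Finset.sum_congr rfl fun p _ => ?_
      simp only [hg]
      split_ifs <;> ring
    have h1 := (abs_le.1 (hK₁ N (by linarith [Real.add_one_le_exp (1 : ℝ)]))).2
    have h2 := hK₂ ε N hε.le (by linarith) hlarge
    have h3 := mul_le_mul_of_nonneg_left h2 (show 0 ≤ 1 - z by linarith)
    rw [hsplit]
    nlinarith
  have hHT := log_mul_sum_prod_primeFactors_le hg0 hg1 hN
  have hexpL : Real.log N = Real.exp L := (Real.exp_log hlogN).symm
  have hS : ∑ D ∈ squarefreeUpTo N, ∏ p ∈ D.primeFactors, g p ≤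
      (1 + Real.log 4) * N * Real.exp (K₁ + K₂ - (1 - z) * ((1 - 2 * ε) * L)) := by
    refine le_of_mul_le_mul_left (hHT.trans ?_) hlogN
    calc _ ≤ (1 + Real.log 4) * N *
          Real.exp (L + (K₁ + K₂) - (1 - z) * ((1 - 2 * ε) * L)) := by gcongr
      _ = _ := by
        rw [hexpL, show L + (K₁ + K₂) - (1 - z) * ((1 - 2 * ε) * L) =
          L + (K₁ + K₂ - (1 - z) * ((1 - 2 * ε) * L)) by ring, Real.exp_add L]
        ring
  calc ((exceptionalSet ε lam N).card : ℝ)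
      ≤ z ^ (-(lam * L)) * ∑ D ∈ squarefreeUpTo N, ∏ p ∈ D.primeFactors, g p :=
        card_exceptionalSet_le_rpow_mul_sum hz hz1.le
    _ ≤ z ^ (-(lam * L)) *
        ((1 + Real.log 4) * N * Real.exp (K₁ + K₂ - (1 - z) * ((1 - 2 * ε) * L))) := by
        gcongr
    _ = (1 + Real.log 4) * N * Real.exp (Real.log z * (-(lam * L)) +
          (K₁ + K₂ - (1 - z) * ((1 - 2 * ε) * L))) := by
        rw [Real.rpow_def_of_pos hz, Real.exp_add (Real.log z * (-(lam * L)))]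
        ring
    _ = _ := by
        rw [show Real.log z * (-(lam * L)) + (K₁ + K₂ - (1 - z) * ((1 - 2 * ε) * L)) =
          (K₁ + K₂) + -((lam * Real.log z - lam + (1 - 2 * ε)) * L) by
            rw [← hzκ]; ring, Real.exp_add (K₁ + K₂)]
        ring
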